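/- Let $(N,g)$ be a smooth compact Riemannian manifold of dimension $n$ (without boundary), and let $1\le k\le n$. Let $\sigma_k$ be the $k$-th elementary symmetric function on $\mathbf R^n$, and let $\Gamma_k^+$ be the connected component of $\{\sigma_k>0\}\subset\mathbf R^n$ that contains the positive cone $\{\lambda : \lambda_i>0 \text{ for all } i\}$. For a symmetric $2$-tensor $A$ on $N$, $\sigma_k(A)$ denotes $\sigma_k$ of the eigenvalues of $A$ with respect to $g$, and $A\in\Gamma_k^+$ means that at every point of $N$ these eigenvalues form a vector in $\Gamma_k^+$. Let $S$ be a $C^0$ symmetric $2$-tensor on $N$ and let $\psi : N\times\mathbf R\to\mathbf R$ be $C^1$. Suppose that (i) $S\in\Gamma_k^+$, and that (ii) $\underline\delta<0<\overline\delta$ are constants with $$\psi(x,\underline\delta)<\sigma_k^{1/k}(S)(x)<\psi(x,\overline\delta)\qquad\text{for all }x\in N .$$ Let $u\in C^2(N)$ be a solution of $$\sigma_k^{1/k}\Big(\nabla^2u+du\otimes du-\tfrac{|\nabla u|^2}{2}\,g+S\Big)=\psi(x,u)>0\qquad\text{on } N,$$ where $\nabla^2 u$ is the Hessian of the Levi-Civita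 connection of $g$, $\sigma_k$ of the tensor on the left is positive, and $\sigma_k^{1/k}$ is its positive $k$-th root. If $\underline\delta\le u\le\overline\delta$ on $N$, then $\underline\delta<u<\overline\delta$ on $N$. -/

import Mathlib

open Bundle Manifold
open scoped ContDiff

noncomputable section

namespace SigmaK

/-! ### Elementary symmetric functions and the cones `Γ_k⁺` -/

/-- The `k`-th elementary symmetric function on `ℝ^m`,
`σ_k(lam) = ∑_{i₁ < ⋯ < i_k} lam_{i₁} ⋯ lam_{i_k}`. -/
def sigma {m : ℕ} (k : ℕ) (lam : Fin m → ℝ) : ℝ :=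
  ∑ s ∈ Finset.powersetCard k (Finset.univ : Finset (Fin m)), ∏ i ∈ s, lam i

/-- `Γ_k⁺`: the connected component of `{σ_k > 0}` that contains the positive cone.
(The positive cone is connected and contains `(1, …, 1)`, so this is the component of
`(1, …, 1)`.) -/
def GammaPlus (m k : ℕ) : Set (Fin m → ℝ) :=
  connectedComponentIn {lam | 0 < sigma k lam} (fun _ => 1)

/-! ### Eigenvalues of symmetric bilinear forms on a Euclidean vector space -/

section Euclidean

variable {V : Type*} [NormedAddCommGroup V] [InnerProductSpace ℝ V] [FiniteDimensional ℝ V]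

/-- The matrix of a bilinear form in an orthonormal basis. -/
def gramMatrix (B : V → V → ℝ) :
    Matrix (Fin (Module.finrank ℝ V)) (Fin (Module.finrank ℝ V)) ℝ :=
  Matrix.of fun i j => B (stdOrthonormalBasis ℝ V i) (stdOrthonormalBasis ℝ V j)

open Classical in
/-- The eigenvalues, with multiplicity, of a symmetric bilinear form with respect to the inner
product (the value in the non-symmetric case is irrelevant). -/
def eigenvalues (B : V → V → ℝ) : Fin (Module.finrank ℝ V) → ℝ :=
  if h : (gramMatrix B).IsHermitian then h.eigenvalues else 0

/-- `σ_k` of the eigenvalues of a symmetric bilinear form. -/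
def sigmaForm (k : ℕ) (B : V → V → ℝ) : ℝ := sigma k (eigenvalues B)

/-- `B ∈ Γ_k⁺`: the eigenvalues of `B` lie in `Γ_k⁺`. -/
def MemGammaPlus (k : ℕ) (B : V → V → ℝ) : Prop :=
  eigenvalues B ∈ GammaPlus (Module.finrank ℝ V) k

end Euclidean

/-! ### The Levi-Civita connection, gradient and Hessian of a Riemannian manifold -/

section Manifold

variable {n : ℕ} {N : Type*} [TopologicalSpace N] [ChartedSpace (EuclideanSpace ℝ (Fin n)) N]

instance (x : N) : FiniteDimensional ℝ (TangentSpace (𝓡 n) x) :=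
  inferInstanceAs (FiniteDimensional ℝ (EuclideanSpace ℝ (Fin n)))

variable [IsManifold (𝓡 n) ∞ N] [RiemannianBundle (fun x : N => TangentSpace (𝓡 n) x)]

instance (x : N) : CompleteSpace (TangentSpace (𝓡 n) x) :=
  FiniteDimensional.complete ℝ (TangentSpace (𝓡 n) x)

/-- A local extension of a tangent vector `v` at `x` to a vector field, smooth near `x`. -/
def localExt {x : N} (v : TangentSpace (𝓡 n) x) (y : N) : TangentSpace (𝓡 n) y :=
  FiberBundle.extend (EuclideanSpace ℝ (Fin n)) v y

/-- The right-hand side of the Koszul formula for `2 ⟨∇_X Y, Z⟩` at `x`. -/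
def koszul (X Y Z : Π y : N, TangentSpace (𝓡 n) y) (x : N) : ℝ :=
  mvfderiv (𝓡 n) (fun y => inner ℝ (Y y) (Z y)) x (X x)
    + mvfderiv (𝓡 n) (fun y => inner ℝ (X y) (Z y)) x (Y x)
    - mvfderiv (𝓡 n) (fun y => inner ℝ (X y) (Y y)) x (Z x)
    + inner ℝ (VectorField.mlieBracket (𝓡 n) X Y x) (Z x)
    - inner ℝ (VectorField.mlieBracket (𝓡 n) X Z x) (Y x)
    - inner ℝ (VectorField.mlieBracket (𝓡 n) Y Z x) (X x)

/-- The Levi-Civita derivative `∇_X Y` at `x`: the tangent vector whose inner product with each `z`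
is given by the Koszul formula, written out in an orthonormal basis of the tangent space. -/
def leviCivita (X Y : Π y : N, TangentSpace (𝓡 n) y) (x : N) : TangentSpace (𝓡 n) x :=
  ∑ i, ((1 / 2 : ℝ) * koszul X Y (localExt (stdOrthonormalBasis ℝ (TangentSpace (𝓡 n) x) i)) x) •
    stdOrthonormalBasis ℝ (TangentSpace (𝓡 n) x) i

/-- The gradient `∇u`. -/
def grad (u : N → ℝ) (x : N) : TangentSpace (𝓡 n) x :=
  (InnerProductSpace.toDual ℝ (TangentSpace (𝓡 n) x)).symm (mvfderiv (𝓡 n) u x)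

/-- The Hessian `∇²u (X, Y) = X (Y u) - (∇_X Y) u` at `x`. -/
def hess (u : N → ℝ) (x : N) (v w : TangentSpace (𝓡 n) x) : ℝ :=
  mvfderiv (𝓡 n) (fun y => mvfderiv (𝓡 n) u y (localExt w y)) x v
    - mvfderiv (𝓡 n) u x (leviCivita (localExt v) (localExt w) x)

/-- The form `∇²u + du ⊗ du - (|∇u|² / 2) g + S` at `x`. -/
def modifiedHess (S : Π x : N, TangentSpace (𝓡 n) x →L[ℝ] TangentSpace (𝓡 n) x →L[ℝ] ℝ)
    (u : N → ℝ) (x : N) (v w : TangentSpace (𝓡 n) x) : ℝ :=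
  hess u x v w + mvfderiv (𝓡 n) u x v * mvfderiv (𝓡 n) u x w
    - ‖grad (n := n) u x‖ ^ 2 / 2 * inner ℝ v w + S x v w

/-- `u` solves `σ_k^{1/k}(∇²u + du ⊗ du - (|∇u|² / 2) g + S) = ψ(x, u) > 0` on `N`. Positivity of
`σ_k` is recorded because the real `k`-th root is meant. -/
def IsSolution (k : ℕ) (S : Π x : N, TangentSpace (𝓡 n) x →L[ℝ] TangentSpace (𝓡 n) x →L[ℝ] ℝ)
    (ψ : N → ℝ → ℝ) (u : N → ℝ) : Prop :=
  ∀ x : N, 0 < sigmaForm k (modifiedHess S u x) ∧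
    sigmaForm k (modifiedHess S u x) ^ (1 / k : ℝ) = ψ x (u x) ∧ 0 < ψ x (u x)

end Manifold

end SigmaK

end

noncomputable section

namespace SigmaK

/-! ### Log-concavity of elementary symmetric functions -/

section Algebra

open Polynomial Matrix

/-! This is a touching argument. Where `u` attains its lower bound it has a minimum, so `du = 0`,
the Hessian is nonnegative, and the modified Hessian is `S + ∇²u ≥ S`. Monotonicity of `σ_k` upwards
from the cone then gives `σ_k^{1/k}(S) ≤ ψ(x, δlo)`, against (ii). At a maximum the inequality
reverses, and monotonicity must start from the modified Hessian, which is only known to satisfy `σ_k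
> 0`.

Its admissibility is propagated. The set `{σ_j > 0, j ≤ k}` is clopen in `{σ_k > 0}`, so on each
component of `N` it is enough to find one admissible point, and the minimum of `u` there is one.
This is `matSigma_modifiedHess_pos`; it needs `σ_j` of the modified Hessian to be continuous.

Both the clopenness and the monotonicity (`matSigma_le_add_posSemidef`) rest on Newton's inequality
`σ_j σ_{j+2} ≤ σ_{j+1}²`, which comes from real-rootedness. -/

theorem splits_derivative {p : ℝ[X]} (hp : p.Splits) : (derivative p).Splits := by
  rw [splits_iff_card_roots] at hp ⊢
  have h1 := card_roots_le_derivative p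
  have h2 := natDegree_derivative_le p
  have h3 := card_roots' (derivative p)
  omega

theorem splits_iterate_derivative {p : ℝ[X]} (hp : p.Splits) (j : ℕ) :
    (derivative^[j] p).Splits := by
  induction j with
  | zero => simpa
  | succ j ih => rw [Function.iterate_succ_apply']; exact splits_derivative ih

/-- Laguerre's inequality. -/
theorem eval_mul_eval_derivative_le_sq {p : ℝ[X]} (hp : p.Splits) (x : ℝ) :
    p.eval x * (derivative (derivative p)).eval x ≤ (derivative p).eval x ^ 2 := by
  induction hp using Submonoid.closure_induction with
  | mem q hq =>
    rcases hq with ⟨a, rfl⟩ | ⟨a, rfl⟩ <;> simp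
  | one => simp
  | mul p q _ _ hp hq =>
    simp only [derivative_mul, derivative_add, eval_add, eval_mul]
    -- With `D p = p'² - p p''` one has `D (pq) = q² D p + p² D q`, so nonnegativity passes to
    -- products.
    nlinarith [mul_nonneg (sub_nonneg.2 hp) (sq_nonneg (q.eval x)),
      mul_nonneg (sub_nonneg.2 hq) (sq_nonneg (p.eval x))]

/-- Laguerre at `0` for the `j`-th derivative, which is again real-rooted. It yields the factors `j
+ 2` on the left and `j + 1` on the right, slightly more than is kept. -/
theorem coeff_mul_coeff_le_sq {p : ℝ[X]} (hp : p.Splits) (j : ℕ) :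
    p.coeff j * p.coeff (j + 2) ≤ p.coeff (j + 1) ^ 2 := by
  have h := eval_mul_eval_derivative_le_sq (splits_iterate_derivative hp j) 0
  rw [← Function.iterate_succ_apply' (⇑derivative) j p,
    ← Function.iterate_succ_apply' (⇑derivative) (j + 1) p] at h
  simp only [← coeff_zero_eq_eval_zero, coeff_iterate_derivative, zero_add,
    Nat.descFactorial_self, nsmul_eq_mul, Nat.factorial_succ, Nat.cast_mul, Nat.succ_eq_add_one,
    Nat.cast_add, Nat.cast_one] at h
  have hf : (0 : ℝ) < (j.factorial : ℝ) ^ 2 := by positivity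
  have h' : ((j : ℝ) + 2) * (p.coeff j * p.coeff (j + 2)) ≤ ((j : ℝ) + 1) * p.coeff (j + 1) ^ 2 := by
    have hj : (0 : ℝ) < (j : ℝ) + 1 := by positivity
    refine le_of_mul_le_mul_left ?_ (mul_pos hf hj)
    norm_num [add_assoc] at h
    linarith
  have hj : (0 : ℝ) ≤ j := by positivity
  nlinarith [sq_nonneg (p.coeff (j + 1)), mul_nonneg hj (sq_nonneg (p.coeff (j + 1)))]

/-- The `j`-th elementary symmetric function of the values of `f` on a finite set. -/
noncomputable def esymmOn {ι : Type*} (s : Finset ι) (f : ι → ℝ) (j : ℕ) : ℝ :=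
  ∑ t ∈ s.powersetCard j, ∏ i ∈ t, f i

variable {ι : Type*} {s : Finset ι} {f : ι → ℝ}

@[simp]
theorem esymmOn_zero : esymmOn s f 0 = 1 := by simp [esymmOn]

theorem esymmOn_of_card_lt {j : ℕ} (h : s.card < j) : esymmOn s f j = 0 := by
  simp [esymmOn, Finset.powersetCard_eq_empty.2 h]

theorem coeff_prod_X_add_C {j : ℕ} (h : j ≤ s.card) :
    (∏ i ∈ s, (X + C (f i))).coeff (s.card - j) = esymmOn s f j := by
  rw [Finset.prod_X_add_C_coeff s f (Nat.sub_le _ _), Nat.sub_sub_self h, esymmOn]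

/-- Newton's inequality without its binomial constant. The coefficients of `∏ (X + f i)` list the
`σ_j` in reverse order, which leaves the inequality unchanged. -/
theorem esymmOn_mul_esymmOn_le_sq (j : ℕ) :
    esymmOn s f j * esymmOn s f (j + 2) ≤ esymmOn s f (j + 1) ^ 2 := by
  rcases lt_or_ge s.card (j + 2) with h | h
  · rw [esymmOn_of_card_lt h, mul_zero]; positivity
  have hs : (∏ i ∈ s, (X + C (f i))).Splits := Splits.prod fun i _ => Splits.X_add_C _
  have := coeff_mul_coeff_le_sq hs (s.card - (j + 2))
  rw [show s.card - (j + 2) + 2 = s.card - j by omega,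
    show s.card - (j + 2) + 1 = s.card - (j + 1) by omega, coeff_prod_X_add_C (by omega),
    coeff_prod_X_add_C (by omega), coeff_prod_X_add_C (by omega)] at this
  linarith

theorem esymmOn_insert [DecidableEq ι] {i : ι} (hi : i ∉ s) (j : ℕ) :
    esymmOn (insert i s) f (j + 1) = esymmOn s f (j + 1) + f i * esymmOn s f j := by
  unfold esymmOn
  rw [Finset.powersetCard_succ_insert hi, Finset.sum_union, Finset.sum_image, Finset.mul_sum]
  · congr 1
    refine Finset.sum_congr rfl fun t ht => ?_
    rw [Finset.prod_insert fun h => hi ((Finset.mem_powersetCard.1 ht).1 h)]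
  · intro a ha b hb hab
    have ha' : i ∉ a := fun h => hi ((Finset.mem_powersetCard.1 ha).1 h)
    have hb' : i ∉ b := fun h => hi ((Finset.mem_powersetCard.1 hb).1 h)
    rw [← Finset.erase_insert ha', ← Finset.erase_insert hb']
    exact congrArg (fun t => t.erase i) hab
  · rw [Finset.disjoint_left]
    intro a ha hb
    obtain ⟨b, -, rfl⟩ := Finset.mem_image.1 hb
    exact hi ((Finset.mem_powersetCard.1 ha).1 (Finset.mem_insert_self _ _))

/-- Removing a variable maps `{σ_j > 0, j ≤ k}` to `{σ_j > 0, j < k}`. -/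
theorem esymmOn_pos_of_insert [DecidableEq ι] {i : ι} (hi : i ∉ s) {k : ℕ}
    (h : ∀ j ≤ k, 0 < esymmOn (insert i s) f j) : ∀ j < k, 0 < esymmOn s f j := by
  intro j
  induction j with
  | zero => simp
  | succ j ih =>
    intro hj
    have h0 := ih (by omega)
    have h1 := h (j + 1) (by omega)
    have h2 := h (j + 2) (by omega)
    have h3 := esymmOn_mul_esymmOn_le_sq (s := s) (f := f) j
    rw [esymmOn_insert hi] at h1 h2
    by_contra! hneg
    -- If `σ_{j+1}(s) ≤ 0`, then `σ_j(s)` times `h2` plus `-σ_{j+1}(s)` times `h1` eliminates `f i`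
    -- and leaves `σ_j σ_{j+2} > σ_{j+1}²` on `s`.
    nlinarith [mul_pos h2 h0, mul_nonneg (neg_nonneg.2 hneg) h1.le]

/-- In `{σ_j > 0, j ≤ k}` one has `σ_{j+1} ≤ σ_1 σ_j`. -/
theorem esymmOn_succ_le_mul {k : ℕ} (h : ∀ j ≤ k, 0 < esymmOn s f j) :
    ∀ j < k, esymmOn s f (j + 1) ≤ esymmOn s f 1 * esymmOn s f j := by
  intro j
  induction j with
  | zero => simp
  | succ j ih =>
    intro hj
    have h0 := h j (by omega)
    have h1 := h (j + 1) (by omega)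
    have h3 := esymmOn_mul_esymmOn_le_sq (s := s) (f := f) j
    have h4 := ih (by omega)
    refine le_of_mul_le_mul_left ?_ h0
    -- `σ_j σ_{j+2} ≤ σ_{j+1}² ≤ σ_1 σ_j σ_{j+1}`, then cancel `σ_j`.
    nlinarith [mul_le_mul_of_nonneg_right h4 h1.le]

/-- A zero at `j` would force `a (j + 1) ≤ 0`, so positivity descends from `k`. Thus closed
conditions together with `σ_k > 0` imply the open ones. -/
theorem pos_of_nonneg_of_succ_le_mul {a : ℕ → ℝ} {k : ℕ} (h0 : ∀ j ≤ k, 0 ≤ a j)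
    (h1 : ∀ j < k, a (j + 1) ≤ a 1 * a j) (hk : 0 < a k) : ∀ j ≤ k, 0 < a j := by
  intro j hj
  induction hj using Nat.decreasingInduction with
  | self => exact hk
  | of_succ j hj ih =>
    refine (h0 j (by omega)).lt_of_ne fun h => ?_
    have := h1 j hj
    rw [← h] at this
    simp at this
    linarith

theorem sigma_eq_esymmOn {m : ℕ} (k : ℕ) (lam : Fin m → ℝ) :
    sigma k lam = esymmOn Finset.univ lam k := rfl

theorem continuous_sigma {m : ℕ} (k : ℕ) : Continuous (sigma (m := m) k) := by
  unfold sigma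
  fun_prop

/-- `U` is open, contains `(1, …, 1)`, and is closed relative to `{σ_k > 0}`, because `σ_{j+1} ≤ σ_1
σ_j` survives limits. Hence it contains the component. -/
theorem sigma_pos_of_mem_GammaPlus {m k : ℕ} (hk : k ≤ m) {lam : Fin m → ℝ}
    (h : lam ∈ GammaPlus m k) : ∀ j ≤ k, 0 < sigma j lam := by
  have hone : ∀ j ≤ k, 0 < sigma j (fun _ : Fin m => (1 : ℝ)) := by
    intro j hj
    have : 0 < m.choose j := Nat.choose_pos (hj.trans hk)
    simpa [sigma] using this
  let U : Set (Fin m → ℝ) := {lam | ∀ j ≤ k, 0 < sigma j lam}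
  have hU : IsOpen U := by
    have : U = ⋂ j ∈ Set.Iic k, {lam | 0 < sigma j lam} := by ext; simp [U]
    rw [this]
    exact (Set.finite_Iic k).isOpen_biInter fun j _ =>
      isOpen_lt continuous_const (continuous_sigma j)
  have hsub : GammaPlus m k ⊆ {lam | 0 < sigma k lam} := connectedComponentIn_subset _ _
  have hcl : closure U ∩ GammaPlus m k ⊆ U := by
    rintro mu ⟨hmu, hmu'⟩
    refine pos_of_nonneg_of_succ_le_mul (a := fun j => sigma j mu) ?_ ?_ (hsub hmu')
    · intro j hj
      exact closure_minimal (t := {lam | 0 ≤ sigma j lam}) (fun lam hlam => (hlam j hj).le)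
        (isClosed_le continuous_const (continuous_sigma j)) hmu
    · intro j hj
      exact closure_minimal (t := {lam | sigma (j + 1) lam ≤ sigma 1 lam * sigma j lam})
        (fun lam hlam => esymmOn_succ_le_mul hlam j hj)
        (isClosed_le (continuous_sigma _) ((continuous_sigma 1).mul (continuous_sigma j))) hmu
  exact isPreconnected_connectedComponentIn.subset_of_closure_inter_subset hU
    ⟨_, mem_connectedComponentIn (hone k le_rfl), hone⟩ hcl h

/-! ### Symmetric matrices -/

/-- The `j`-th elementary symmetric function of the eigenvalues of a matrix, as a coefficient of
the characteristic polynomial. -/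
noncomputable def matSigma [Fintype ι] [DecidableEq ι] (j : ℕ) (A : Matrix ι ι ℝ) : ℝ :=
  (-1) ^ j * A.charpoly.coeff (Fintype.card ι - j)

theorem coeff_prod_X_sub_C {j : ℕ} (h : j ≤ s.card) :
    (∏ i ∈ s, (X - C (f i))).coeff (s.card - j) = (-1) ^ j * esymmOn s f j := by
  have : ∏ i ∈ s, (X - C (f i)) = ∏ i ∈ s, (X + C ((fun i => -f i) i)) := by
    simp [sub_eq_add_neg]
  rw [this, coeff_prod_X_add_C h, esymmOn, esymmOn, Finset.mul_sum]
  refine Finset.sum_congr rfl fun t ht => ?_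
  rw [Finset.prod_neg, (Finset.mem_powersetCard.1 ht).2]

/-- Characteristic coefficients are polynomial in the entries and similarity invariant, so
continuity and change of basis need no tracking of eigenvalues. For `j > m` the truncated
subtraction would pick the constant coefficient. -/
theorem matSigma_eq_sigma {m j : ℕ} (hj : j ≤ m) {A : Matrix (Fin m) (Fin m) ℝ}
    (hA : A.IsHermitian) : matSigma j A = sigma j hA.eigenvalues := by
  have := coeff_prod_X_sub_C (s := (Finset.univ : Finset (Fin m))) (f := hA.eigenvalues)
    (j := j) (by simpa)
  rw [matSigma, hA.charpoly_eq, sigma_eq_esymmOn, Fintype.card_fin]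
  simp only [Finset.card_univ, Fintype.card_fin] at this
  simp only [RCLike.ofReal_real_eq_id, id_eq]
  rw [this, ← mul_assoc, ← mul_pow]
  simp

theorem continuous_matSigma [Fintype ι] [DecidableEq ι] (j : ℕ) :
    Continuous (matSigma (ι := ι) j) := by
  refine continuous_const.mul ?_
  have : (fun A : Matrix ι ι ℝ => A.charpoly.coeff (Fintype.card ι - j)) = fun A =>
      MvPolynomial.eval (fun p : ι × ι => A p.1 p.2)
        ((Matrix.charpoly.univ ℝ ι).coeff (Fintype.card ι - j)) := by
    ext A
    have := Matrix.charpoly.univ_coeff_eval₂Hom (n := ι) (RingHom.id ℝ)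
      (fun p : ι × ι => A p.1 p.2) (Fintype.card ι - j)
    rw [MvPolynomial.eval]
    exact this.symm
  rw [this]
  refine (MvPolynomial.continuous_eval _).comp ?_
  exact continuous_pi fun p => continuous_id.matrix_elem p.1 p.2

/-- The matrix determinant lemma for a rank-one perturbation of an invertible diagonal matrix. -/
theorem det_diagonal_sub_vecMulVec {m : ℕ} (d w : Fin m → ℝ) (hd : ∀ i, d i ≠ 0) :
    (Matrix.diagonal d - Matrix.vecMulVec w w).det
      = ∏ i, d i - ∑ i, w i ^ 2 * ∏ l ∈ Finset.univ.erase i, d l := by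
  have hdet : (Matrix.diagonal d).det = ∏ i, d i := Matrix.det_diagonal
  have hne : ∏ i, d i ≠ 0 := Finset.prod_ne_zero_iff.2 fun i _ => hd i
  have h := Matrix.det_add_replicateCol_mul_replicateRow (ι := Unit) (A := Matrix.diagonal d)
    (by rw [hdet]; exact isUnit_iff_ne_zero.2 hne) (-w) w
  have hrep : Matrix.replicateCol Unit (-w) * Matrix.replicateRow Unit w
      = -Matrix.vecMulVec w w := by
    rw [← Matrix.vecMulVec_eq, Matrix.neg_vecMulVec]
  rw [hrep, ← sub_eq_add_neg, hdet] at h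
  rw [h, Matrix.det_unique, Matrix.inv_def, hdet, Matrix.adjugate_diagonal]
  simp only [Ring.inverse_eq_inv', Matrix.mul_smul, Matrix.smul_mul, Matrix.add_apply,
    Matrix.one_apply_eq, Matrix.smul_apply, Matrix.mul_apply, Matrix.diagonal_apply,
    Matrix.replicateRow_apply, Matrix.replicateCol_apply, mul_ite, mul_zero, smul_eq_mul,
    Finset.sum_ite_eq', Finset.mem_univ, if_true, Pi.neg_apply]
  rw [mul_add, mul_one, ← mul_assoc, mul_inv_cancel₀ hne, one_mul, sub_eq_add_neg,
    ← Finset.sum_neg_distrib]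
  congr 1
  exact Finset.sum_congr rfl fun i _ => by ring

theorem charpoly_diagonal_add_vecMulVec {m : ℕ} (d w : Fin m → ℝ) :
    (Matrix.diagonal d + Matrix.vecMulVec w w).charpoly
      = ∏ i, (X - C (d i)) - ∑ i, C (w i ^ 2) * ∏ l ∈ Finset.univ.erase i, (X - C (d l)) := by
  refine Polynomial.eq_of_infinite_eval_eq _ _ ?_
  -- The determinant formula needs `x` outside the range of `d`; infinitely many such `x` determine
  -- the polynomial.
  refine Set.Infinite.mono (s := (Set.range d)ᶜ) ?_ (Set.finite_range d).infinite_compl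
  intro x hx
  have hne : ∀ i, x - d i ≠ 0 := fun i h => hx ⟨i, by linarith⟩
  have := det_diagonal_sub_vecMulVec (fun i => x - d i) w hne
  rw [Set.mem_ofPred_eq, Matrix.eval_charpoly]
  simp only [eval_sub, eval_prod, eval_finsetSum, eval_mul, eval_C, eval_X]
  rw [← this]
  congr 1
  ext i j
  by_cases hij : i = j
  · simp [hij, Matrix.scalar_apply]; ring
  · simp [hij, Matrix.scalar_apply]

theorem matSigma_diagonal_add_vecMulVec {m j : ℕ} (hj : j + 1 ≤ m) (d w : Fin m → ℝ) :
    matSigma (j + 1) (Matrix.diagonal d + Matrix.vecMulVec w w)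
      = sigma (j + 1) d + ∑ i, w i ^ 2 * esymmOn (Finset.univ.erase i) d j := by
  have h1 := coeff_prod_X_sub_C (s := (Finset.univ : Finset (Fin m))) (f := d)
    (j := j + 1) (by simpa)
  have h2 : ∀ i : Fin m, (∏ l ∈ Finset.univ.erase i, (X - C (d l))).coeff (m - (j + 1))
      = (-1) ^ j * esymmOn (Finset.univ.erase i) d j := by
    intro i
    have hc : (Finset.univ.erase i).card = m - 1 := by simp
    have := coeff_prod_X_sub_C (s := Finset.univ.erase i) (f := d) (j := j) (by omega)
    rwa [hc, show m - 1 - j = m - (j + 1) by omega] at this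
  simp only [Finset.card_univ, Fintype.card_fin] at h1
  rw [matSigma, Fintype.card_fin, charpoly_diagonal_add_vecMulVec, coeff_sub, finsetSum_coeff, h1]
  simp only [coeff_C_mul, h2]
  have hsq : ((-1 : ℝ) ^ (j + 1)) * (-1) ^ (j + 1) = 1 := by rw [← mul_pow]; simp
  have hsq' : ((-1 : ℝ) ^ (j + 1)) * (-1) ^ j = -1 := by
    rw [pow_succ, mul_right_comm, ← mul_pow]; simp
  rw [mul_sub, ← mul_assoc, hsq, one_mul, Finset.mul_sum, sub_eq_add_neg, ← Finset.sum_neg_distrib,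
    sigma_eq_esymmOn]
  congr 1
  refine Finset.sum_congr rfl fun i _ => ?_
  linear_combination (-(w i ^ 2 * esymmOn (Finset.univ.erase i) d j)) * hsq'

theorem matSigma_conj [Fintype ι] [DecidableEq ι] (j : ℕ) (A P Q : Matrix ι ι ℝ) (h : Q * P = 1) :
    matSigma j (P * A * Q) = matSigma j A := by
  rw [matSigma, matSigma, Matrix.charpoly_mul_comm, ← mul_assoc, h, one_mul]

/-- In an eigenbasis of `A` the increment of `σ_{j+1}` is exactly `∑ w_i² σ_j(λ without λ_i)`, and
`esymmOn_pos_of_insert` makes each term nonnegative. -/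
theorem matSigma_le_add_vecMulVec {m k : ℕ} (hk : k ≤ m) {A : Matrix (Fin m) (Fin m) ℝ}
    (hA : A.IsHermitian) (h : ∀ j ≤ k, 0 < matSigma j A) (v : Fin m → ℝ) :
    ∀ j ≤ k, matSigma j A ≤ matSigma j (A + Matrix.vecMulVec v v) := by
  intro j hj
  have hpos : ∀ j ≤ k, 0 < esymmOn Finset.univ hA.eigenvalues j := fun j hj => by
    rw [← sigma_eq_esymmOn, ← matSigma_eq_sigma (hj.trans hk) hA]; exact h j hj
  rcases j with _ | j
  · simp [matSigma, show ∀ B : Matrix (Fin m) (Fin m) ℝ, B.charpoly.coeff m = 1 from fun B => by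
        have := B.charpoly_monic
        rwa [Polynomial.Monic, Polynomial.leadingCoeff, B.charpoly_natDegree_eq_dim,
          Fintype.card_fin] at this]
  let U : Matrix (Fin m) (Fin m) ℝ := hA.eigenvectorUnitary
  have hU : star U * U = 1 := Unitary.coe_star_mul_self hA.eigenvectorUnitary
  have hU' : U * star U = 1 := Unitary.coe_mul_star_self hA.eigenvectorUnitary
  have hspec : A = U * Matrix.diagonal hA.eigenvalues * star U := by
    have := hA.spectral_theorem
    simpa [Unitary.conjStarAlgAut_apply] using this
  have hw : Matrix.vecMulVec v v
      = U * Matrix.vecMulVec (star U *ᵥ v) (star U *ᵥ v) * star U := by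
    rw [Matrix.mul_vecMulVec, Matrix.vecMulVec_mul, Matrix.mulVec_mulVec, hU', Matrix.one_mulVec,
      ← Matrix.mulVec_transpose]
    congr 1
    rw [Matrix.mulVec_mulVec, Matrix.star_eq_conjTranspose, Matrix.conjTranspose_eq_transpose_of_trivial,
      Matrix.transpose_transpose]
    rw [Matrix.star_eq_conjTranspose, Matrix.conjTranspose_eq_transpose_of_trivial] at hU'
    rw [hU', Matrix.one_mulVec]
  have hsum : A + Matrix.vecMulVec v v = U * (Matrix.diagonal hA.eigenvalues
      + Matrix.vecMulVec (star U *ᵥ v) (star U *ᵥ v)) * star U := by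
    rw [Matrix.mul_add, Matrix.add_mul, ← hspec, ← hw]
  rw [hsum, matSigma_conj _ _ _ _ hU, matSigma_diagonal_add_vecMulVec (hj.trans hk),
    matSigma_eq_sigma (hj.trans hk) hA, le_add_iff_nonneg_right]
  refine Finset.sum_nonneg fun i _ => mul_nonneg (sq_nonneg _) ?_
  refine (esymmOn_pos_of_insert (Finset.notMem_erase i Finset.univ) (k := k) ?_ j (by omega)).le
  rwa [Finset.insert_erase (Finset.mem_univ i)]

/-- `σ_j`, `j ≤ k`, are monotone on the symmetric matrices with `σ_1, …, σ_k > 0`. -/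
theorem matSigma_le_add_posSemidef {m k : ℕ} (hk : k ≤ m) {A P : Matrix (Fin m) (Fin m) ℝ}
    (hA : A.IsHermitian) (h : ∀ j ≤ k, 0 < matSigma j A) (hP : P.PosSemidef) :
    ∀ j ≤ k, matSigma j A ≤ matSigma j (A + P) := by
  obtain ⟨r, v, rfl⟩ := Matrix.posSemidef_iff_eq_sum_vecMulVec.1 hP
  -- Rank-one terms are added one at a time; the inequality for `t` itself keeps the partial sum in
  -- the cone.
  suffices H : ∀ t : Finset (Fin r),
      ∀ j ≤ k, matSigma j A ≤ matSigma j (A + ∑ i ∈ t, Matrix.vecMulVec (v i) (star (v i))) from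
    H Finset.univ
  intro t
  induction t using Finset.induction_on with
  | empty => simp
  | insert i t hi ih =>
    intro j hj
    have hH : (A + ∑ i ∈ t, Matrix.vecMulVec (v i) (star (v i))).IsHermitian :=
      hA.add (Matrix.posSemidef_sum t fun i _ => Matrix.posSemidef_vecMulVec_self_star _).1
    have := matSigma_le_add_vecMulVec hk hH (fun j hj => (h j hj).trans_le (ih j hj)) (v i) j hj
    rw [Finset.sum_insert hi, add_comm (Matrix.vecMulVec _ _), ← add_assoc]
    exact (ih j hj).trans (by simpa using this)

end Algebra

/-! ### Bilinear forms on a Euclidean space, in arbitrary bases -/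

section Forms

open Matrix

variable {V : Type*} [NormedAddCommGroup V] [InnerProductSpace ℝ V] {ι : Type*} [Fintype ι]

/-- The Gram matrix of the inner product in a basis. -/
noncomputable def innerMatrix (b : ι → V) : Matrix ι ι ℝ := Matrix.of fun i j => inner ℝ (b i) (b j)

theorem innerMatrix_eq (b : Module.Basis ι ℝ V) (o : OrthonormalBasis ι ℝ V) :
    innerMatrix b = (o.toBasis.toMatrix b)ᵀ * o.toBasis.toMatrix b := by
  ext i j
  rw [innerMatrix, Matrix.of_apply, Matrix.mul_apply, ← o.sum_inner_mul_inner]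
  simp [Module.Basis.toMatrix_apply, o.repr_apply_apply, real_inner_comm]

variable [DecidableEq ι]

theorem inv_innerMatrix_eq (b : Module.Basis ι ℝ V) (o : OrthonormalBasis ι ℝ V) :
    (innerMatrix b)⁻¹ = b.toMatrix o * (b.toMatrix o)ᵀ := by
  have h1 := o.toBasis.toMatrix_mul_toMatrix_flip b
  have h2 := b.toMatrix_mul_toMatrix_flip o.toBasis
  rw [OrthonormalBasis.coe_toBasis] at h1 h2
  refine Matrix.inv_eq_right_inv ?_
  rw [innerMatrix_eq b o, Matrix.mul_assoc, ← Matrix.mul_assoc (o.toBasis.toMatrix b), h1,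
    Matrix.one_mul, ← Matrix.transpose_mul, h2, Matrix.transpose_one]

variable [FiniteDimensional ℝ V]

theorem sigmaForm_eq_matSigma {B : V → V → ℝ} (hB : (gramMatrix B).IsHermitian) {j : ℕ}
    (hj : j ≤ Module.finrank ℝ V) : sigmaForm j B = matSigma j (gramMatrix B) := by
  rw [sigmaForm, eigenvalues, dif_pos hB, matSigma_eq_sigma hj hB]

/-- The default eigenvalues of a non-symmetric form are `0`, with `σ_k = 0` for `k ≥ 1`. So the
equation itself gives symmetry of the modified Hessian. -/
theorem isHermitian_gramMatrix_of_sigmaForm_pos {B : V → V → ℝ} {k : ℕ} (hk : 1 ≤ k)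
    (h : 0 < sigmaForm k B) : (gramMatrix B).IsHermitian := by
  by_contra hB
  rw [sigmaForm, eigenvalues, dif_neg hB, sigma] at h
  refine h.ne' (Finset.sum_eq_zero fun s hs => ?_)
  obtain ⟨i, hi⟩ : s.Nonempty := by
    rw [← Finset.card_pos, (Finset.mem_powersetCard.1 hs).2]; omega
  exact Finset.prod_eq_zero hi rfl

theorem isHermitian_gramMatrix {B : V → V → ℝ} (h : ∀ v w, B v w = B w v) :
    (gramMatrix B).IsHermitian := by
  ext i j
  simp [gramMatrix, h]

theorem matSigma_pos_of_memGammaPlus {B : V → V → ℝ} (hB : (gramMatrix B).IsHermitian) {k : ℕ}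
    (hk : k ≤ Module.finrank ℝ V) (h : MemGammaPlus k B) :
    ∀ j ≤ k, 0 < matSigma j (gramMatrix B) := by
  intro j hj
  rw [← sigmaForm_eq_matSigma hB (hj.trans hk)]
  exact sigma_pos_of_mem_GammaPlus hk h j hj

theorem matSigma_gramMatrix_le {B : V → V → ℝ} (hB : (gramMatrix B).IsHermitian) {k : ℕ}
    (hk : k ≤ Module.finrank ℝ V) (h : ∀ j ≤ k, 0 < matSigma j (gramMatrix B))
    {B' : V → V → ℝ} (hB' : (gramMatrix B').IsHermitian) (H : V →ₗ[ℝ] V →ₗ[ℝ] ℝ)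
    (hH : ∀ v w, B' v w = B v w + H v w) (hpos : ∀ v, 0 ≤ H v v) :
    ∀ j ≤ k, matSigma j (gramMatrix B) ≤ matSigma j (gramMatrix B') := by
  have hsum : gramMatrix B' = gramMatrix B + gramMatrix (fun v w => H v w) := by
    ext i j; simp [gramMatrix, hH]
  have hpsd : (gramMatrix (fun v w => H v w)).PosSemidef := by
    refine Matrix.PosSemidef.of_dotProduct_mulVec_nonneg ?_ fun c => ?_
    · have : gramMatrix (fun v w => H v w) = gramMatrix B' - gramMatrix B := by
        rw [hsum, add_sub_cancel_left]
      rw [this]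
      exact hB'.sub hB
    · have := hpos (∑ i, c i • stdOrthonormalBasis ℝ V i)
      simp only [map_sum, map_smul, LinearMap.sum_apply, LinearMap.smul_apply, smul_eq_mul] at this
      simp only [Finset.mul_sum] at this
      rw [Finset.sum_comm] at this
      simpa [dotProduct, mulVec, gramMatrix, Finset.mul_sum, mul_comm, mul_left_comm] using this
  rw [hsum]
  exact matSigma_le_add_posSemidef hk hB h hpsd

theorem isUnit_det_innerMatrix (b : Module.Basis ι ℝ V) : IsUnit (innerMatrix b).det := by
  let o : OrthonormalBasis ι ℝ V := (stdOrthonormalBasis ℝ V).reindex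
    (Fintype.equivOfCardEq (by rw [Fintype.card_fin, Module.finrank_eq_card_basis b]))
  have h1 := b.toMatrix_mul_toMatrix_flip o.toBasis
  rw [innerMatrix_eq b o, Matrix.det_mul, Matrix.det_transpose]
  have := Matrix.isUnit_det_of_left_inverse h1
  exact this.mul this

/-- `G⁻¹B` in any basis is similar to the matrix in an orthonormal one. This permits a continuous
frame in place of `stdOrthonormalBasis`, which is chosen separately at each point. -/
theorem matSigma_gramMatrix_eq (b : Module.Basis ι ℝ V) (B : V →ₗ[ℝ] V →ₗ[ℝ] ℝ) (j : ℕ) :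
    matSigma j (gramMatrix fun v w => B v w)
      = matSigma j ((innerMatrix b)⁻¹ * Matrix.of fun i j => B (b i) (b j)) := by
  let e : Fin (Module.finrank ℝ V) ≃ ι :=
    Fintype.equivOfCardEq (by rw [Fintype.card_fin, Module.finrank_eq_card_basis b])
  let o : OrthonormalBasis ι ℝ V := (stdOrthonormalBasis ℝ V).reindex e
  have h2 := b.toMatrix_mul_toMatrix_flip o.toBasis
  have h1 := o.toBasis.toMatrix_mul_toMatrix_flip b
  rw [OrthonormalBasis.coe_toBasis] at h1 h2
  have hB := LinearMap.BilinForm.toMatrix_mul_basis_toMatrix o.toBasis b B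
  have hb : (Matrix.of fun i j => B (b i) (b j)) = LinearMap.BilinForm.toMatrix b B := by
    ext i j; simp [LinearMap.BilinForm.toMatrix_apply]
  have ho : LinearMap.BilinForm.toMatrix o.toBasis B
      = Matrix.reindex e e (gramMatrix fun v w => B v w) := by
    ext i j; simp [LinearMap.BilinForm.toMatrix_apply, gramMatrix, o]
  have hr : matSigma j (Matrix.reindex e e (gramMatrix fun v w => B v w))
      = matSigma j (gramMatrix fun v w => B v w) := by
    rw [matSigma, matSigma, Matrix.charpoly_reindex, Fintype.card_congr e]
  rw [hb, ← hB, inv_innerMatrix_eq b o, ← Matrix.mul_assoc, Matrix.mul_assoc (b.toMatrix o),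
    ← Matrix.mul_assoc _ (o.toBasis.toMatrix b)ᵀ, ← Matrix.transpose_mul, h1,
    Matrix.transpose_one, Matrix.one_mul, matSigma_conj _ _ _ _ h1, ho, hr]

/-- The inner product of two linear forms, in an orthonormal basis and in an arbitrary one. -/
theorem sum_mul_eq_dotProduct {κ : Type*} [Fintype κ] (b : Module.Basis ι ℝ V)
    (o : OrthonormalBasis κ ℝ V) (α β : V →ₗ[ℝ] ℝ) :
    ∑ l, α (o l) * β (o l)
      = (fun i => α (b i)) ⬝ᵥ (innerMatrix b)⁻¹ *ᵥ fun i => β (b i) := by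
  classical
  -- Represent `β` by a vector `c`; both sides then equal `α c`.
  obtain ⟨c, hc⟩ : ∃ c : V, ∀ v, β v = inner ℝ v c :=
    ⟨(InnerProductSpace.toDual ℝ V).symm (LinearMap.toContinuousLinearMap β), fun v => by
      rw [real_inner_comm, InnerProductSpace.toDual_symm_apply]; rfl⟩
  have h1 : ∑ l, α (o l) * β (o l) = α c := by
    conv_rhs => rw [← o.sum_repr c, map_sum]
    exact Finset.sum_congr rfl fun l _ => by
      rw [map_smul, smul_eq_mul, o.repr_apply_apply, hc, mul_comm]
  have h2 : (fun i => β (b i)) = innerMatrix b *ᵥ fun i => b.repr c i := by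
    ext i
    rw [hc]
    conv_lhs => rw [← b.sum_repr c, inner_sum]
    simp [innerMatrix, mulVec, dotProduct, inner_smul_right, mul_comm]
  rw [h1, h2, Matrix.mulVec_mulVec, Matrix.nonsing_inv_mul _ (isUnit_det_innerMatrix b),
    Matrix.one_mulVec]
  conv_lhs => rw [← b.sum_repr c, map_sum]
  simp [dotProduct, mul_comm]

end Forms

section Manifold

variable {n : ℕ} {N : Type*} [TopologicalSpace N] [ChartedSpace (EuclideanSpace ℝ (Fin n)) N]

section Regularity

/-! ### Derivatives of functions along vector fields -/

/-- The function `f` is differentiable at `x`. -/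
abbrev DiffFun (f : N → ℝ) (x : N) : Prop := MDifferentiableAt (𝓡 n) 𝓘(ℝ, ℝ) f x

/-- The function `f` is `C^m` at `x`. -/
abbrev SmoothFun (m : ℕ∞ω) (f : N → ℝ) (x : N) : Prop := ContMDiffAt (𝓡 n) 𝓘(ℝ, ℝ) m f x

variable [IsManifold (𝓡 n) 1 N]

/-- The vector field `X` is differentiable at `x`. -/
abbrev DiffField (X : Π y : N, TangentSpace (𝓡 n) y) (x : N) : Prop :=
  MDifferentiableAt (𝓡 n) (𝓡 n).tangent
    (fun y => TotalSpace.mk' (EuclideanSpace ℝ (Fin n)) y (X y)) x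

/-- The vector field `X` is `C^m` at `x`. -/
abbrev SmoothField (m : ℕ∞ω) (X : Π y : N, TangentSpace (𝓡 n) y) (x : N) : Prop :=
  ContMDiffAt (𝓡 n) (𝓡 n).tangent m
    (fun y => TotalSpace.mk' (EuclideanSpace ℝ (Fin n)) y (X y)) x

variable {f : N → ℝ} {X : Π y : N, TangentSpace (𝓡 n) y} {x : N}

theorem smoothFun_mvfderiv_apply {m m' : ℕ∞ω} (hf : SmoothFun (n := n) m' f x)
    (hX : SmoothField m X x) (hm : m + 1 ≤ m') :
    SmoothFun (n := n) m (fun y => mvfderiv (𝓡 n) f y (X y)) x := by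
  have h := (hf.mfderiv_const hm).clm_apply_of_inCoordinates hX
    (hf.of_le (le_self_add.trans hm))
  exact (contMDiff_snd_tangentBundle_modelSpace ℝ 𝓘(ℝ, ℝ)).contMDiffAt.comp x h

theorem diffFun_mvfderiv_apply (hf : SmoothFun (n := n) 2 f x) (hX : DiffField X x) :
    DiffFun (n := n) (fun y => mvfderiv (𝓡 n) f y (X y)) x := by
  have h1 := (hf.mfderiv_const (m := 1) (by norm_num)).mdifferentiableAt one_ne_zero
  have h := h1.clm_apply_of_inCoordinates hX (hf.mdifferentiableAt two_ne_zero)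
  exact ((contMDiff_snd_tangentBundle_modelSpace (n := 1) ℝ 𝓘(ℝ, ℝ)).contMDiffAt.mdifferentiableAt
    one_ne_zero).comp x h

end Regularity

variable [IsManifold (𝓡 n) ∞ N]

theorem diffField_localExt {x : N} (v : TangentSpace (𝓡 n) x) : DiffField (localExt v) x :=
  FiberBundle.mdifferentiableAt_extend (𝓡 n) (EuclideanSpace ℝ (Fin n)) v

theorem smoothField_localExt {x : N} (v : TangentSpace (𝓡 n) x) : SmoothField 1 (localExt v) x :=
  FiberBundle.contMDiffAt_extend (𝓡 n) (EuclideanSpace ℝ (Fin n)) v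

@[simp]
theorem localExt_self {x : N} (v : TangentSpace (𝓡 n) x) : localExt v x = v :=
  FiberBundle.extend_apply_self _ v

variable [RiemannianBundle (fun x : N => TangentSpace (𝓡 n) x)]

theorem mvfderiv_leviCivita {u : N → ℝ} {x : N}
    (X Y : Π y : N, TangentSpace (𝓡 n) y) :
    mvfderiv (𝓡 n) u x (leviCivita X Y x) = ∑ i, 1 / 2 * koszul X Y
      (localExt (stdOrthonormalBasis ℝ (TangentSpace (𝓡 n) x) i)) x
        * mvfderiv (𝓡 n) u x (stdOrthonormalBasis ℝ (TangentSpace (𝓡 n) x) i) := by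
  simp only [leviCivita, map_sum, map_smul, smul_eq_mul]

variable
  [IsContMDiffRiemannianBundle (𝓡 n) ∞ (EuclideanSpace ℝ (Fin n))
      (fun x : N => TangentSpace (𝓡 n) x)]

/-! ### Tensoriality of the Koszul expression and of the Hessian -/

variable {X X' Y Y' Z Z' : Π y : N, TangentSpace (𝓡 n) y} {x : N} {f : N → ℝ}

theorem diffFun_inner (hX : DiffField X x) (hY : DiffField Y x) :
    DiffFun (n := n) (fun y => inner ℝ (X y) (Y y)) x :=
  have : IsContMDiffRiemannianBundle (𝓡 n) 1 (EuclideanSpace ℝ (Fin n))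
      (fun x : N => TangentSpace (𝓡 n) x) := IsContMDiffRiemannianBundle.of_le (n := ∞) (by simp)
  hX.inner_bundle hY

theorem koszul_smul_left (hf : DiffFun (n := n) f x) (hX : DiffField X x)
    (hY : DiffField Y x) (hZ : DiffField Z x) :
    koszul (f • X) Y Z x = f x * koszul X Y Z x := by
  simp only [koszul, Pi.smul_apply', real_inner_smul_left,
    mvfderiv_fun_mul hf (diffFun_inner hX hY), mvfderiv_fun_mul hf (diffFun_inner hX hZ),
    VectorField.mlieBracket_smul_left hf hX, map_smul, inner_add_left, real_inner_smul_right,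
    add_apply, smul_apply, smul_eq_mul]
  rw [real_inner_comm (Y x) (X x), real_inner_comm (Z x) (X x)]
  ring

/-- The additional term is the Leibniz rule of `∇_X (fY)`, doubled; in the Hessian it cancels
against that of `X (f · Yu)`. -/
theorem koszul_smul_middle (hf : DiffFun (n := n) f x) (hX : DiffField X x)
    (hY : DiffField Y x) (hZ : DiffField Z x) :
    koszul X (f • Y) Z x
      = f x * koszul X Y Z x + 2 * mvfderiv (𝓡 n) f x (X x) * inner ℝ (Y x) (Z x) := by
  simp only [koszul, Pi.smul_apply', real_inner_smul_left, real_inner_smul_right,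
    mvfderiv_fun_mul hf (diffFun_inner hX hY), mvfderiv_fun_mul hf (diffFun_inner hY hZ),
    VectorField.mlieBracket_smul_left hf hY, VectorField.mlieBracket_smul_right hf hY,
    map_smul, inner_add_left,
    add_apply, smul_apply, smul_eq_mul]
  rw [real_inner_comm (Y x) (X x)]
  ring

theorem koszul_smul_right (hf : DiffFun (n := n) f x) (hX : DiffField X x)
    (hY : DiffField Y x) (hZ : DiffField Z x) :
    koszul X Y (f • Z) x = f x * koszul X Y Z x := by
  simp only [koszul, Pi.smul_apply', real_inner_smul_left, real_inner_smul_right,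
    mvfderiv_fun_mul hf (diffFun_inner hX hZ), mvfderiv_fun_mul hf (diffFun_inner hY hZ),
    VectorField.mlieBracket_smul_right hf hZ, map_smul, inner_add_left,
    add_apply, smul_apply, smul_eq_mul]
  rw [real_inner_comm (Z x) (X x), real_inner_comm (Z x) (Y x)]
  ring

theorem koszul_add_left (hX : DiffField X x) (hX' : DiffField X' x)
    (hY : DiffField Y x) (hZ : DiffField Z x) :
    koszul (X + X') Y Z x = koszul X Y Z x + koszul X' Y Z x := by
  simp only [koszul, Pi.add_apply, inner_add_left, inner_add_right,
    mvfderiv_fun_add (diffFun_inner hX hY) (diffFun_inner hX' hY),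
    mvfderiv_fun_add (diffFun_inner hX hZ) (diffFun_inner hX' hZ),
    VectorField.mlieBracket_add_left hX hX', map_add, add_apply]
  ring

theorem koszul_add_middle (hX : DiffField X x) (hY : DiffField Y x) (hY' : DiffField Y' x)
    (hZ : DiffField Z x) :
    koszul X (Y + Y') Z x = koszul X Y Z x + koszul X Y' Z x := by
  simp only [koszul, Pi.add_apply, inner_add_left, inner_add_right,
    mvfderiv_fun_add (diffFun_inner hX hY) (diffFun_inner hX hY'),
    mvfderiv_fun_add (diffFun_inner hY hZ) (diffFun_inner hY' hZ),
    VectorField.mlieBracket_add_left hY hY', VectorField.mlieBracket_add_right hY hY',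
    map_add, add_apply]
  ring

theorem koszul_add_right (hX : DiffField X x) (hY : DiffField Y x) (hZ : DiffField Z x)
    (hZ' : DiffField Z' x) :
    koszul X Y (Z + Z') x = koszul X Y Z x + koszul X Y Z' x := by
  simp only [koszul, Pi.add_apply, inner_add_left, inner_add_right,
    mvfderiv_fun_add (diffFun_inner hX hZ) (diffFun_inner hX hZ'),
    mvfderiv_fun_add (diffFun_inner hY hZ) (diffFun_inner hY hZ'),
    VectorField.mlieBracket_add_right hZ hZ', map_add, add_apply]
  ring

theorem tensorialAt_koszul (hX : DiffField X x) (hY : DiffField Y x) :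
    TensorialAt (𝓡 n) (EuclideanSpace ℝ (Fin n)) (fun Z => koszul X Y Z x) x where
  smul hf hZ := koszul_smul_right hf hX hY hZ
  add hZ hZ' := koszul_add_right hX hY hZ hZ'

/-- `⟨2 ∇_X Y, ·⟩` at `x`, as a linear form. -/
def koszulForm (hX : DiffField X x) (hY : DiffField Y x) : TangentSpace (𝓡 n) x →L[ℝ] ℝ :=
  TensorialAt.mkHom _ x (tensorialAt_koszul hX hY)

theorem koszulForm_apply (hX : DiffField X x) (hY : DiffField Y x) (hZ : DiffField Z x) :
    koszulForm hX hY (Z x) = koszul X Y Z x :=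
  TensorialAt.mkHom_apply (tensorialAt_koszul hX hY) hZ

theorem koszulForm_apply_localExt (hX : DiffField X x) (hY : DiffField Y x)
    (v : TangentSpace (𝓡 n) x) : koszulForm hX hY v = koszul X Y (localExt v) x := rfl

/-- The Hessian, evaluated on vector fields. -/
def hessFields (u : N → ℝ) (x : N) (X Y : Π y : N, TangentSpace (𝓡 n) y) : ℝ :=
  mvfderiv (𝓡 n) (fun y => mvfderiv (𝓡 n) u y (Y y)) x (X x)
    - mvfderiv (𝓡 n) u x (leviCivita X Y x)

variable {u : N → ℝ}

theorem tensorialAt_hessFields_left (hY : DiffField Y x) :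
    TensorialAt (𝓡 n) (EuclideanSpace ℝ (Fin n)) (fun X => hessFields u x X Y) x where
  smul {f X} hf hX := by
    simp only [hessFields, mvfderiv_leviCivita,
      koszul_smul_left hf hX hY (diffField_localExt _), Pi.smul_apply', map_smul, smul_eq_mul,
      mul_sub, Finset.mul_sum]
    congr 1
    exact Finset.sum_congr rfl fun i _ => by ring
  add {X X'} hX hX' := by
    simp only [hessFields, mvfderiv_leviCivita,
      koszul_add_left hX hX' hY (diffField_localExt _), Pi.add_apply, map_add, mul_add, add_mul,
      Finset.sum_add_distrib]
    ring

theorem tensorialAt_hessFields_right (hu : SmoothFun (n := n) 2 u x) (hX : DiffField X x) :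
    TensorialAt (𝓡 n) (EuclideanSpace ℝ (Fin n)) (fun Y => hessFields u x X Y) x where
  smul {f Y} hf hY := by
    -- The Leibniz term of the Koszul sum appears expanded in the orthonormal basis; this collects
    -- it into `du(Y)`.
    have hsum : mvfderiv (𝓡 n) u x (Y x) = ∑ i,
        inner ℝ (Y x) (stdOrthonormalBasis ℝ (TangentSpace (𝓡 n) x) i)
          * mvfderiv (𝓡 n) u x (stdOrthonormalBasis ℝ (TangentSpace (𝓡 n) x) i) := by
      conv_lhs => rw [← (stdOrthonormalBasis ℝ (TangentSpace (𝓡 n) x)).sum_repr (Y x)]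
      rw [map_sum]
      refine Finset.sum_congr rfl fun i _ => ?_
      rw [map_smul, OrthonormalBasis.repr_apply_apply, real_inner_comm, smul_eq_mul]
    simp only [hessFields, mvfderiv_leviCivita,
      koszul_smul_middle hf hX hY (diffField_localExt _), Pi.smul_apply', map_smul, smul_eq_mul,
      mvfderiv_fun_mul hf (diffFun_mvfderiv_apply hu hY), localExt_self,
      add_apply, smul_apply]
    rw [hsum, mul_sub, Finset.mul_sum, Finset.sum_mul, add_sub_assoc, ← Finset.sum_sub_distrib,
      sub_eq_add_neg (_ * _), ← Finset.sum_neg_distrib]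
    congr 1
    exact Finset.sum_congr rfl fun i _ => by ring
  add {Y Y'} hY hY' := by
    simp only [hessFields, mvfderiv_leviCivita,
      koszul_add_middle hX hY hY' (diffField_localExt _), Pi.add_apply, map_add,
      mvfderiv_fun_add (diffFun_mvfderiv_apply hu hY) (diffFun_mvfderiv_apply hu hY'),
      add_apply, mul_add, add_mul, Finset.sum_add_distrib]
    ring

/-- The Hessian at a point as a bilinear form. -/
def hessForm (hu : SmoothFun (n := n) 2 u x) :
    TangentSpace (𝓡 n) x →L[ℝ] TangentSpace (𝓡 n) x →L[ℝ] ℝ :=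
  TensorialAt.mkHom₂ (hessFields u x) x (fun _ hY => tensorialAt_hessFields_left hY)
    (fun _ hX => tensorialAt_hessFields_right hu hX)

theorem hessForm_eq_hess (hu : SmoothFun (n := n) 2 u x) (v w : TangentSpace (𝓡 n) x) :
    hessForm hu v w = hess u x v w := by
  have : hessForm hu v w = hessFields u x (localExt v) (localExt w) := rfl
  rw [this, hessFields, hess, localExt_self]

/-- `hess` extends its vectors separately at each base point. Tensoriality replaces these extensions
by one frame valid on a neighbourhood, so that continuity can be read off. -/
theorem hess_eq_hessFields (hu : SmoothFun (n := n) 2 u x) (hX : DiffField X x)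
    (hY : DiffField Y x) : hess u x (X x) (Y x) = hessFields u x X Y := by
  rw [← hessForm_eq_hess hu]
  exact TensorialAt.mkHom₂_apply _ _ hX hY

end Manifold

/-! ### Continuity of the `σ_j` of the modified Hessian, by coordinate frames -/

section Continuity

open Filter Topology
open scoped Matrix

theorem continuousAt_dotProduct_mulVec {T : Type*} [TopologicalSpace T] {n : ℕ} {x₀ : T} {a c : T → Fin n → ℝ}
    {A : T → Matrix (Fin n) (Fin n) ℝ} (ha : ContinuousAt a x₀) (hA : ContinuousAt A x₀)
    (hc : ContinuousAt c x₀) : ContinuousAt (fun y => a y ⬝ᵥ A y *ᵥ c y) x₀ := by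
  have : Continuous fun p : (Fin n → ℝ) × Matrix (Fin n) (Fin n) ℝ × (Fin n → ℝ) =>
      p.1 ⬝ᵥ p.2.1 *ᵥ p.2.2 :=
    continuous_fst.dotProduct (continuous_snd.fst.matrix_mulVec continuous_snd.snd)
  exact this.continuousAt.comp (ha.prodMk (hA.prodMk hc))

variable {n : ℕ} {N : Type*} [TopologicalSpace N] [ChartedSpace (EuclideanSpace ℝ (Fin n)) N]
  [IsManifold (𝓡 n) ∞ N]

/-- The coordinate frame of the tangent bundle near `x₀`. -/
def frame (x₀ : N) (i : Fin n) : Π y : N, TangentSpace (𝓡 n) y :=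
  (trivializationAt (EuclideanSpace ℝ (Fin n)) (fun y : N => TangentSpace (𝓡 n) y) x₀).localFrame
    (EuclideanSpace.basisFun (Fin n) ℝ).toBasis i

theorem smoothField_frame (x₀ : N) (i : Fin n) (m : ℕ) : SmoothField m (frame x₀ i) x₀ := by
  have : SmoothField ∞ (frame x₀ i) x₀ :=
    contMDiffAt_localFrame_of_mem ∞ _ _ i (FiberBundle.mem_baseSet_trivializationAt' x₀)
  exact this.of_le (by exact_mod_cast le_top)

theorem eventually_diffField_frame (x₀ : N) :
    ∀ᶠ y in 𝓝 x₀, ∀ i : Fin n, DiffField (frame x₀ i) y := by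
  refine Filter.eventually_all.2 fun i => ?_
  filter_upwards [(trivializationAt (EuclideanSpace ℝ (Fin n))
    (fun y : N => TangentSpace (𝓡 n) y) x₀).open_baseSet.mem_nhds
      (FiberBundle.mem_baseSet_trivializationAt' x₀)] with y hy
  exact (contMDiffAt_localFrame_of_mem 1 _ _ i hy).mdifferentiableAt one_ne_zero

theorem eventually_exists_basis_eq_frame (x₀ : N) :
    ∀ᶠ y in 𝓝 x₀, ∃ b : Module.Basis (Fin n) ℝ (TangentSpace (𝓡 n) y),
      ∀ i, b i = frame x₀ i y := by
  filter_upwards [(trivializationAt (EuclideanSpace ℝ (Fin n))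
    (fun y : N => TangentSpace (𝓡 n) y) x₀).open_baseSet.mem_nhds
      (FiberBundle.mem_baseSet_trivializationAt' x₀)] with y hy
  exact ⟨Trivialization.basisAt _ (EuclideanSpace.basisFun (Fin n) ℝ).toBasis hy,
    fun i => (Trivialization.localFrame_apply_of_mem_baseSet _ _ hy).symm⟩

variable {u : N → ℝ}

theorem continuousAt_mvfderiv_frame {x₀ : N} (hu : SmoothFun (n := n) 2 u x₀) (i : Fin n) :
    ContinuousAt (fun y => mvfderiv (𝓡 n) u y (frame x₀ i y)) x₀ :=
  (smoothFun_mvfderiv_apply (m := (0 : ℕ)) hu (smoothField_frame x₀ i 0) (by norm_num)).continuousAt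

theorem smoothField_mlieBracket {X Y : Π y : N, TangentSpace (𝓡 n) y} {x : N}
    (hX : SmoothField (1 : ℕ) X x) (hY : SmoothField (1 : ℕ) Y x) :
    SmoothField (0 : ℕ) (VectorField.mlieBracket (𝓡 n) X Y) x := by
  have : IsManifold (𝓡 n) (((1 : ℕ) : ℕ∞) + 1) N := IsManifold.of_le (n := ∞) (by exact_mod_cast le_top)
  have : IsManifold (𝓡 n) (minSmoothness ℝ 2) N :=
    IsManifold.of_le (n := ∞) (by
      rw [minSmoothness_of_isRCLikeNormedField]; exact ENat.LEInfty.out)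
  refine ContMDiffAt.mlieBracket_vectorField (m := (0 : ℕ)) (n := (1 : ℕ)) hX hY ?_
  simp

variable {S : Π x : N, TangentSpace (𝓡 n) x →L[ℝ] TangentSpace (𝓡 n) x →L[ℝ] ℝ}

theorem continuousAt_tensor_frame {x₀ : N} (hS : Continuous fun x : N =>
      TotalSpace.mk' (EuclideanSpace ℝ (Fin n) →L[ℝ] EuclideanSpace ℝ (Fin n) →L[ℝ] ℝ)
        (E := fun x : N => TangentSpace (𝓡 n) x →L[ℝ] TangentSpace (𝓡 n) x →L[ℝ] ℝ) x (S x))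
    (i j : Fin n) : ContinuousAt (fun y => S y (frame x₀ i y) (frame x₀ j y)) x₀ := by
  have h := ContinuousAt.clm_bundle_apply₂ (F₁ := EuclideanSpace ℝ (Fin n))
    (F₂ := EuclideanSpace ℝ (Fin n)) (F₃ := ℝ) (E₃ := Bundle.Trivial N ℝ) (b := id)
    hS.continuousAt (smoothField_frame x₀ i 0).continuousAt (smoothField_frame x₀ j 0).continuousAt
  simp only [FiberBundle.continuousAt_totalSpace] at h
  exact h.2

variable [RiemannianBundle (fun x : N => TangentSpace (𝓡 n) x)]
  [IsContMDiffRiemannianBundle (𝓡 n) ∞ (EuclideanSpace ℝ (Fin n))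
      (fun x : N => TangentSpace (𝓡 n) x)]

variable {X Y Z : Π y : N, TangentSpace (𝓡 n) y} {x : N}

theorem smoothFun_inner {m : ℕ} (hX : SmoothField m X x) (hY : SmoothField m Y x) :
    SmoothFun (n := n) m (fun y => inner ℝ (X y) (Y y)) x :=
  have : IsContMDiffRiemannianBundle (𝓡 n) (m : ℕ∞ω) (EuclideanSpace ℝ (Fin n))
      (fun x : N => TangentSpace (𝓡 n) x) :=
    IsContMDiffRiemannianBundle.of_le (n := ∞) (by exact_mod_cast le_top)
  hX.inner_bundle hY

theorem continuousAt_koszul (hX : SmoothField (1 : ℕ) X x) (hY : SmoothField (1 : ℕ) Y x)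
    (hZ : SmoothField (1 : ℕ) Z x) : ContinuousAt (koszul X Y Z) x := by
  have h : ∀ {X Y Z : Π y : N, TangentSpace (𝓡 n) y}, SmoothField (1 : ℕ) X x →
      SmoothField (1 : ℕ) Y x → SmoothField (1 : ℕ) Z x →
      ContinuousAt (fun y => mvfderiv (𝓡 n) (fun y => inner ℝ (Y y) (Z y)) y (X y)) x :=
    fun hX hY hZ => (smoothFun_mvfderiv_apply (m := (0 : ℕ)) (smoothFun_inner hY hZ)
      (hX.of_le (by norm_num)) (by norm_num)).continuousAt
  have h' : ∀ {X Y Z : Π y : N, TangentSpace (𝓡 n) y}, SmoothField (1 : ℕ) X x →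
      SmoothField (1 : ℕ) Y x → SmoothField (1 : ℕ) Z x →
      ContinuousAt (fun y => inner ℝ (VectorField.mlieBracket (𝓡 n) X Y y) (Z y)) x :=
    fun hX hY hZ => (smoothFun_inner (smoothField_mlieBracket hX hY)
      (hZ.of_le (by norm_num))).continuousAt
  exact (((((h hX hY hZ).add (h hY hX hZ)).sub (h hZ hX hY)).add (h' hX hY hZ)).sub
    (h' hX hZ hY)).sub (h' hY hZ hX)

/-- The Gram matrix of the coordinate frame. -/
def frameMatrix (x₀ y : N) : Matrix (Fin n) (Fin n) ℝ := innerMatrix fun i : Fin n => frame x₀ i y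

theorem continuousAt_inv_frameMatrix (x₀ : N) : ContinuousAt (fun y => (frameMatrix (n := n) x₀ y)⁻¹) x₀ := by
  have hc : ContinuousAt (frameMatrix (n := n) x₀) x₀ := by
    refine continuousAt_pi.2 fun i => continuousAt_pi.2 fun j => ?_
    exact (smoothFun_inner (smoothField_frame x₀ i 0) (smoothField_frame x₀ j 0)).continuousAt
  obtain ⟨b, hb⟩ := (eventually_exists_basis_eq_frame (n := n) x₀).self_of_nhds
  have hdet : (frameMatrix (n := n) x₀ x₀).det ≠ 0 := by
    have := isUnit_det_innerMatrix b
    rw [funext hb] at this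
    exact this.ne_zero
  simp only [Matrix.inv_def, Ring.inverse_eq_inv']
  have hd : ContinuousAt (fun y => (frameMatrix (n := n) x₀ y).det) x₀ :=
    (Continuous.matrix_det continuous_id).continuousAt.comp hc
  have ha : ContinuousAt (fun y => (frameMatrix (n := n) x₀ y).adjugate) x₀ :=
    (Continuous.matrix_adjugate continuous_id).continuousAt.comp hc
  exact (hd.inv₀ hdet).smul ha

theorem continuousAt_hess_frame {x₀ : N} (hu : ContMDiff (𝓡 n) 𝓘(ℝ, ℝ) 2 u) (i j : Fin n) :
    ContinuousAt (fun y => hess u y (frame x₀ i y) (frame x₀ j y)) x₀ := by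
  have h1 : ContinuousAt (fun y => mvfderiv (𝓡 n)
      (fun z => mvfderiv (𝓡 n) u z (frame x₀ j z)) y (frame x₀ i y)) x₀ :=
    (smoothFun_mvfderiv_apply (m := (0 : ℕ)) (m' := (1 : ℕ))
      (smoothFun_mvfderiv_apply (hu x₀) (smoothField_frame x₀ j 1) (by norm_num))
      (smoothField_frame x₀ i 0) (by norm_num)).continuousAt
  have h2 : ContinuousAt (fun y => 1 / 2 *
      ((fun l => koszul (frame x₀ i) (frame x₀ j) (frame x₀ l) y) ⬝ᵥ
        (frameMatrix x₀ y)⁻¹ *ᵥ fun l => mvfderiv (𝓡 n) u y (frame x₀ l y))) x₀ := by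
    refine continuousAt_const.mul (continuousAt_dotProduct_mulVec ?_
      (continuousAt_inv_frameMatrix x₀) ?_)
    · exact continuousAt_pi.2 fun l => continuousAt_koszul (smoothField_frame x₀ i 1)
        (smoothField_frame x₀ j 1) (smoothField_frame x₀ l 1)
    · exact continuousAt_pi.2 fun l => continuousAt_mvfderiv_frame (hu x₀) l
  refine (h1.sub h2).congr ?_
  filter_upwards [eventually_diffField_frame (n := n) x₀, eventually_exists_basis_eq_frame (n := n) x₀]
    with y hy ⟨b, hb⟩
  rw [hess_eq_hessFields (hu y) (hy i) (hy j), hessFields, mvfderiv_leviCivita]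
  -- The sum over the pointwise orthonormal basis becomes a contraction with the inverse Gram matrix
  -- of the frame, all of whose ingredients are continuous.
  have h := sum_mul_eq_dotProduct b (stdOrthonormalBasis ℝ (TangentSpace (𝓡 n) y))
    (koszulForm (hy i) (hy j)).toLinearMap (mvfderiv (𝓡 n) u y).toLinearMap
  simp only [ContinuousLinearMap.coe_coe, koszulForm_apply_localExt, funext hb] at h
  simp only [← koszulForm_apply_localExt (hy i) (hy j), koszulForm_apply (hy i) (hy j) (hy _)] at h
  simp only [mul_assoc, ← Finset.mul_sum]
  simp only [frameMatrix, Pi.sub_apply]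
  rw [← h]
  rfl

theorem continuousAt_norm_grad_sq {x₀ : N} (hu : SmoothFun (n := n) 2 u x₀) :
    ContinuousAt (fun y => ‖grad (n := n) u y‖ ^ 2) x₀ := by
  have h : ContinuousAt (fun y => (fun l => mvfderiv (𝓡 n) u y (frame x₀ l y)) ⬝ᵥ
      (frameMatrix x₀ y)⁻¹ *ᵥ fun l => mvfderiv (𝓡 n) u y (frame x₀ l y)) x₀ :=
    continuousAt_dotProduct_mulVec
      (continuousAt_pi.2 fun l => continuousAt_mvfderiv_frame hu l)
      (continuousAt_inv_frameMatrix x₀)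
      (continuousAt_pi.2 fun l => continuousAt_mvfderiv_frame hu l)
  refine h.congr ?_
  filter_upwards [eventually_exists_basis_eq_frame (n := n) x₀] with y ⟨b, hb⟩
  have h := sum_mul_eq_dotProduct b (stdOrthonormalBasis ℝ (TangentSpace (𝓡 n) y))
    (mvfderiv (𝓡 n) u y).toLinearMap (mvfderiv (𝓡 n) u y).toLinearMap
  simp only [ContinuousLinearMap.coe_coe, funext hb] at h
  have hg : ∀ v, mvfderiv (𝓡 n) u y v = inner ℝ (grad (n := n) u y) v := fun v => by
    rw [grad, InnerProductSpace.toDual_symm_apply]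
  rw [frameMatrix, ← h, ← real_inner_self_eq_norm_sq,
    ← (stdOrthonormalBasis ℝ (TangentSpace (𝓡 n) y)).sum_inner_mul_inner]
  refine Finset.sum_congr rfl fun l _ => ?_
  rw [hg, real_inner_comm (grad (n := n) u y)]

/-- The tensor `∇²u + du ⊗ du - (|∇u|² / 2) g + S` as a bilinear form. -/
def modifiedHessForm (S : Π x : N, TangentSpace (𝓡 n) x →L[ℝ] TangentSpace (𝓡 n) x →L[ℝ] ℝ)
    {u : N → ℝ} {x : N} (hu : SmoothFun (n := n) 2 u x) :
    TangentSpace (𝓡 n) x →ₗ[ℝ] TangentSpace (𝓡 n) x →ₗ[ℝ] ℝ :=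
  LinearMap.mk₂ ℝ (modifiedHess S u x)
    (fun v v' w => by
      simp only [modifiedHess, ← hessForm_eq_hess hu, map_add, add_apply, inner_add_left]; ring)
    (fun c v w => by
      simp only [modifiedHess, ← hessForm_eq_hess hu, map_smul, smul_apply, real_inner_smul_left,
        smul_eq_mul]
      ring)
    (fun v w w' => by
      simp only [modifiedHess, ← hessForm_eq_hess hu, map_add, inner_add_right]; ring)
    (fun c v w => by
      simp only [modifiedHess, ← hessForm_eq_hess hu, map_smul, real_inner_smul_right, smul_eq_mul]
      ring)

theorem continuous_matSigma_modifiedHess (hS : Continuous fun x : N =>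
      TotalSpace.mk' (EuclideanSpace ℝ (Fin n) →L[ℝ] EuclideanSpace ℝ (Fin n) →L[ℝ] ℝ)
        (E := fun x : N => TangentSpace (𝓡 n) x →L[ℝ] TangentSpace (𝓡 n) x →L[ℝ] ℝ) x (S x))
    (hu : ContMDiff (𝓡 n) 𝓘(ℝ, ℝ) 2 u) (j : ℕ) :
    Continuous fun y => matSigma j (gramMatrix (modifiedHess S u y)) := by
  refine continuous_iff_continuousAt.2 fun x₀ => ?_
  have hB : ContinuousAt (fun y => Matrix.of fun i j =>
      modifiedHess S u y (frame x₀ i y) (frame x₀ j y)) x₀ := by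
    refine continuousAt_pi.2 fun i => continuousAt_pi.2 fun j => ?_
    exact (((continuousAt_hess_frame hu i j).add ((continuousAt_mvfderiv_frame (hu x₀) i).mul
      (continuousAt_mvfderiv_frame (hu x₀) j))).sub
      (((continuousAt_norm_grad_sq (hu x₀)).div_const 2).mul
        (smoothFun_inner (smoothField_frame x₀ i 0) (smoothField_frame x₀ j 0)).continuousAt)).add
      (continuousAt_tensor_frame hS i j)
  have hmul : ContinuousAt (fun y => (frameMatrix x₀ y)⁻¹ * Matrix.of fun i j =>
      modifiedHess S u y (frame x₀ i y) (frame x₀ j y)) x₀ :=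
    (continuousAt_inv_frameMatrix x₀).mul hB
  refine ((continuous_matSigma j).continuousAt.comp hmul).congr ?_
  filter_upwards [eventually_exists_basis_eq_frame (n := n) x₀] with y ⟨b, hb⟩
  have h := matSigma_gramMatrix_eq b (modifiedHessForm S (hu y)) j
  simp only [funext hb] at h
  exact h.symm

end Continuity

section CriticalPoints

open Filter Topology

/-! ### The gradient and the Hessian at a local extremum -/

/-- A positive second derivative would make `t` a local minimum too, hence `f` locally constant. -/
theorem deriv_deriv_nonpos_of_isLocalMax {f : ℝ → ℝ} {t : ℝ} (h : IsLocalMax f t)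
    (hc : ContinuousAt f t) : deriv (deriv f) t ≤ 0 := by
  by_contra! hpos
  have hmin := isLocalMin_of_deriv_deriv_pos hpos h.deriv_eq_zero hc
  have hconst : f =ᶠ[𝓝 t] fun _ => f t := by
    filter_upwards [h, hmin] with s h1 h2 using le_antisymm h1 h2
  rw [hconst.deriv.deriv_eq] at hpos
  simp at hpos

theorem matSigma_succ_le_mul {k m : ℕ}
    {A : Matrix (Fin m) (Fin m) ℝ} (hA : A.IsHermitian) (hkm : k ≤ m)
    (hpos : ∀ j ≤ k, 0 < matSigma j A) :
    ∀ j < k, matSigma (j + 1) A ≤ matSigma 1 A * matSigma j A := by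
  intro j hj
  have h : ∀ j ≤ k, matSigma j A = esymmOn Finset.univ hA.eigenvalues j := fun j hj =>
    matSigma_eq_sigma (hj.trans hkm) hA
  rw [h _ hj, h _ hj.le, h 1 (by omega)]
  exact esymmOn_succ_le_mul (fun j hj => (h j hj) ▸ hpos j hj) j hj

variable {n : ℕ} {N : Type*} [TopologicalSpace N] [ChartedSpace (EuclideanSpace ℝ (Fin n)) N]

theorem hasDerivAt_comp_of_hasMFDerivAt {f : N → ℝ} {γ : ℝ → N} {t : ℝ}
    {v : TangentSpace (𝓡 n) (γ t)}
    (hγ : HasMFDerivAt 𝓘(ℝ, ℝ) (𝓡 n) γ t ((1 : ℝ →L[ℝ] ℝ).smulRight v))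
    (hf : DiffFun (n := n) f (γ t)) :
    HasDerivAt (f ∘ γ) (mvfderiv (𝓡 n) f (γ t) v) t := by
  have h : HasFDerivAt (f ∘ γ)
      ((1 : ℝ →L[ℝ] ℝ).smulRight (mvfderiv (𝓡 n) f (γ t) v)) t := by
    refine hasMFDerivAt_iff_hasFDerivAt.1 ((hf.hasMFDerivAt.comp t hγ).congr_mfderiv ?_)
    ext
    exact (mvfderiv (𝓡 n) f (γ t)).map_smul (1 : ℝ) v
  simpa using h.hasDerivAt

theorem finrank_tangentSpace (x : N) : Module.finrank ℝ (TangentSpace (𝓡 n) x) = n :=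
  finrank_euclideanSpace_fin

variable [IsManifold (𝓡 n) ∞ N] {u : N → ℝ} {x : N}

/-- `γ` is an integral curve of the local extension `X` of `v`, so `(u ∘ γ)' = (Xu) ∘ γ` near `0`
and the second derivative is `X(Xu)`. At a critical point the connection term of the Hessian
vanishes, so no geodesic is needed. -/
theorem exists_curve (hu : ContMDiff (𝓡 n) 𝓘(ℝ, ℝ) 2 u) (v : TangentSpace (𝓡 n) x) :
    ∃ γ : ℝ → N, γ 0 = x ∧ ContinuousAt γ 0 ∧ ContinuousAt (u ∘ γ) 0 ∧
      deriv (u ∘ γ) 0 = mvfderiv (𝓡 n) u x v ∧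
      deriv (deriv (u ∘ γ)) 0
        = mvfderiv (𝓡 n) (fun y => mvfderiv (𝓡 n) u y (localExt v y)) x v := by
  have : IsManifold (𝓡 n) 1 N := IsManifold.of_le (n := ∞) (by simp)
  obtain ⟨γ, rfl, hγ⟩ := exists_isMIntegralCurveAt_of_contMDiffAt_boundaryless (t₀ := 0)
    (smoothField_localExt v)
  have hd : deriv (u ∘ γ) =ᶠ[𝓝 0] (fun y => mvfderiv (𝓡 n) u y (localExt v y)) ∘ γ := by
    filter_upwards [hγ] with t ht
    exact (hasDerivAt_comp_of_hasMFDerivAt ht ((hu _).mdifferentiableAt two_ne_zero)).deriv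
  have h0 := hγ.self_of_nhds
  refine ⟨γ, rfl, h0.continuousAt, (hu.continuous.continuousAt).comp h0.continuousAt, ?_, ?_⟩
  · rw [hd.self_of_nhds, Function.comp_apply, localExt_self]
  · rw [hd.deriv_eq, (hasDerivAt_comp_of_hasMFDerivAt h0
      (diffFun_mvfderiv_apply (hu _) (diffField_localExt v))).deriv, localExt_self]

theorem mvfderiv_eq_zero_of_isLocalExtr (hu : ContMDiff (𝓡 n) 𝓘(ℝ, ℝ) 2 u)
    (hx : IsLocalExtr u x) : mvfderiv (𝓡 n) u x = 0 := by
  ext v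
  obtain ⟨γ, rfl, hγ, -, hd, -⟩ := exists_curve hu v
  rw [← hd]
  exact IsLocalExtr.deriv_eq_zero (hx.comp_tendsto hγ)

variable [RiemannianBundle (fun x : N => TangentSpace (𝓡 n) x)]

theorem hess_nonpos_of_isLocalMax (hu : ContMDiff (𝓡 n) 𝓘(ℝ, ℝ) 2 u) (hx : IsLocalMax u x)
    (v : TangentSpace (𝓡 n) x) : hess u x v v ≤ 0 := by
  rw [hess, mvfderiv_eq_zero_of_isLocalExtr hu (Or.inr hx)]
  obtain ⟨γ, rfl, hγ, hc, -, hdd⟩ := exists_curve hu v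
  rw [← hdd]
  simpa using deriv_deriv_nonpos_of_isLocalMax (hx.comp_tendsto hγ) hc

theorem hess_nonneg_of_isLocalMin (hu : ContMDiff (𝓡 n) 𝓘(ℝ, ℝ) 2 u) (hx : IsLocalMin u x)
    (v : TangentSpace (𝓡 n) x) : 0 ≤ hess u x v v := by
  rw [hess, mvfderiv_eq_zero_of_isLocalExtr hu (Or.inl hx)]
  obtain ⟨γ, rfl, hγ, hc, -, hdd⟩ := exists_curve hu v
  rw [← hdd]
  have h := deriv_deriv_nonpos_of_isLocalMax (hx.comp_tendsto hγ).neg hc.neg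
  have h2 : deriv (fun t => -(u ∘ γ) t) = fun t => -deriv (u ∘ γ) t := by
    ext t; exact deriv.fun_neg
  change deriv (deriv fun t => -(u ∘ γ) t) 0 ≤ 0 at h
  rw [h2, deriv.fun_neg] at h
  simpa using h

variable {S : Π x : N, TangentSpace (𝓡 n) x →L[ℝ] TangentSpace (𝓡 n) x →L[ℝ] ℝ}

theorem modifiedHess_of_isLocalExtr (hu : ContMDiff (𝓡 n) 𝓘(ℝ, ℝ) 2 u) (hx : IsLocalExtr u x)
    (v w : TangentSpace (𝓡 n) x) : modifiedHess S u x v w = S x v w + hess u x v w := by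
  rw [modifiedHess, grad, mvfderiv_eq_zero_of_isLocalExtr hu hx]
  simp [add_comm]

variable
  [IsContMDiffRiemannianBundle (𝓡 n) ∞ (EuclideanSpace ℝ (Fin n))
      (fun x : N => TangentSpace (𝓡 n) x)]

/-! ### The comparison at extrema -/

variable {k : ℕ}

/-- The Hessian as a bilinear form, without topology. -/
def hessBilin (hu : ContMDiff (𝓡 n) 𝓘(ℝ, ℝ) 2 u) (x : N) :
    TangentSpace (𝓡 n) x →ₗ[ℝ] TangentSpace (𝓡 n) x →ₗ[ℝ] ℝ :=
  LinearMap.mk₂ ℝ (hess u x)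
    (fun v v' w => by simp only [← hessForm_eq_hess (hu x), map_add, add_apply])
    (fun c v w => by simp only [← hessForm_eq_hess (hu x), map_smul, smul_apply])
    (fun v w w' => by simp only [← hessForm_eq_hess (hu x), map_add])
    (fun c v w => by simp only [← hessForm_eq_hess (hu x), map_smul])

theorem matSigma_le_of_isLocalMin (hkn : k ≤ n) (hu : ContMDiff (𝓡 n) 𝓘(ℝ, ℝ) 2 u)
    (hx : IsLocalMin u x) (hSsymm : ∀ v w, S x v w = S x w v)
    (hS : MemGammaPlus k (fun v w => S x v w))
    (hM : (gramMatrix (modifiedHess S u x)).IsHermitian) :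
    ∀ j ≤ k, matSigma j (gramMatrix fun v w => S x v w)
      ≤ matSigma j (gramMatrix (modifiedHess S u x)) :=
  matSigma_gramMatrix_le (isHermitian_gramMatrix hSsymm)
    (hkn.trans_eq (finrank_tangentSpace x).symm)
    (matSigma_pos_of_memGammaPlus (isHermitian_gramMatrix hSsymm)
      (hkn.trans_eq (finrank_tangentSpace x).symm) hS) hM (hessBilin hu x)
    (fun v w => modifiedHess_of_isLocalExtr hu (Or.inl hx) v w)
    (hess_nonneg_of_isLocalMin hu hx)

theorem matSigma_le_of_isLocalMax (hkn : k ≤ n) (hu : ContMDiff (𝓡 n) 𝓘(ℝ, ℝ) 2 u)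
    (hx : IsLocalMax u x) (hSsymm : ∀ v w, S x v w = S x w v)
    (hpos : ∀ j ≤ k, 0 < matSigma j (gramMatrix (modifiedHess S u x)))
    (hM : (gramMatrix (modifiedHess S u x)).IsHermitian) :
    ∀ j ≤ k, matSigma j (gramMatrix (modifiedHess S u x))
      ≤ matSigma j (gramMatrix fun v w => S x v w) :=
  matSigma_gramMatrix_le hM (hkn.trans_eq (finrank_tangentSpace x).symm) hpos
    (isHermitian_gramMatrix hSsymm) (-hessBilin hu x)
    (fun v w => by
      rw [modifiedHess_of_isLocalExtr hu (Or.inr hx)]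
      change _ = _ + -hess u x v w
      ring)
    (fun v => neg_nonneg.2 (hess_nonpos_of_isLocalMax hu hx v))

/-- On a component of a compact manifold, admissibility spreads from the minimum of `u` to every
point. -/
theorem matSigma_modifiedHess_pos [CompactSpace N] (hk1 : 1 ≤ k) (hkn : k ≤ n)
    (hSsymm : ∀ x v w, S x v w = S x w v)
    (hScont : Continuous fun x : N =>
      TotalSpace.mk' (EuclideanSpace ℝ (Fin n) →L[ℝ] EuclideanSpace ℝ (Fin n) →L[ℝ] ℝ)
        (E := fun x : N => TangentSpace (𝓡 n) x →L[ℝ] TangentSpace (𝓡 n) x →L[ℝ] ℝ) x (S x))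
    (hS : ∀ x : N, MemGammaPlus k (fun v w => S x v w))
    (hu : ContMDiff (𝓡 n) 𝓘(ℝ, ℝ) 2 u)
    (hsol : ∀ x : N, 0 < sigmaForm k (modifiedHess S u x)) (x : N) :
    ∀ j ≤ k, 0 < matSigma j (gramMatrix (modifiedHess S u x)) := by
  have : LocallyConnectedSpace N :=
    ChartedSpace.locallyConnectedSpace (EuclideanSpace ℝ (Fin n)) N
  have hM : ∀ y, (gramMatrix (modifiedHess S u y)).IsHermitian := fun y =>
    isHermitian_gramMatrix_of_sigmaForm_pos hk1 (hsol y)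
  have hkf : ∀ y : N, k ≤ Module.finrank ℝ (TangentSpace (𝓡 n) y) := fun y =>
    hkn.trans_eq (finrank_tangentSpace y).symm
  have hcont := continuous_matSigma_modifiedHess hScont hu
  let P : Set N := {y | ∀ j ≤ k, 0 < matSigma j (gramMatrix (modifiedHess S u y))}
  let Q : Set N := {y | (∀ j ≤ k, 0 ≤ matSigma j (gramMatrix (modifiedHess S u y))) ∧
    ∀ j < k, matSigma (j + 1) (gramMatrix (modifiedHess S u y))
      ≤ matSigma 1 (gramMatrix (modifiedHess S u y)) * matSigma j (gramMatrix (modifiedHess S u y))}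
  -- `P` is visibly open and `Q` visibly closed; they agree because `σ_k > 0` everywhere.
  have hPQ : P = Q := by
    ext y
    refine ⟨fun h => ⟨fun j hj => (h j hj).le, matSigma_succ_le_mul (hM y) (hkf y) h⟩, fun h => ?_⟩
    refine pos_of_nonneg_of_succ_le_mul h.1 h.2 ?_
    rw [← sigmaForm_eq_matSigma (hM y) (hkf y)]
    exact hsol y
  have hopen : IsOpen P := by
    have : P = ⋂ j ∈ Set.Iic k, {y | 0 < matSigma j (gramMatrix (modifiedHess S u y))} := by
      ext y; simp [P]
    rw [this]
    exact (Set.finite_Iic k).isOpen_biInter fun j _ => isOpen_lt continuous_const (hcont j)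
  have hclosed : IsClosed P := by
    rw [hPQ]
    have : Q = (⋂ j ∈ Set.Iic k, {y | 0 ≤ matSigma j (gramMatrix (modifiedHess S u y))}) ∩
        ⋂ j ∈ Set.Iio k, {y | matSigma (j + 1) (gramMatrix (modifiedHess S u y))
          ≤ matSigma 1 (gramMatrix (modifiedHess S u y))
            * matSigma j (gramMatrix (modifiedHess S u y))} := by
      ext y; simp [Q]
    rw [this]
    exact (isClosed_biInter fun j _ => isClosed_le continuous_const (hcont j)).inter
      (isClosed_biInter fun j _ => isClosed_le (hcont _) ((hcont 1).mul (hcont j)))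
  -- `N` may be disconnected, so `u` is minimised on the component of `x`; it is open, and the
  -- minimum is therefore a local one in `N`.
  obtain ⟨z, hz, hmin⟩ := (isClosed_connectedComponent (x := x)).isCompact.exists_isMinOn
    ⟨x, mem_connectedComponent⟩ hu.continuous.continuousOn
  have hlmin : IsLocalMin u z := hmin.isLocalMin (isOpen_connectedComponent.mem_nhds hz)
  have hzP : z ∈ P := fun j hj =>
    (matSigma_pos_of_memGammaPlus (isHermitian_gramMatrix (hSsymm z)) (hkf z) (hS z) j hj).trans_le
      (matSigma_le_of_isLocalMin hkn hu hlmin (hSsymm z) (hS z) (hM z) j hj)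
  have hsub := (show IsClopen P from ⟨hclosed, hopen⟩).connectedComponent_subset hzP
  rw [← connectedComponent_eq hz] at hsub
  exact hsub mem_connectedComponent

end CriticalPoints

end SigmaK

end

/-! ### The touching argument at the two bounds -/

theorem mainTheorem9 {n : ℕ} {N : Type*} [TopologicalSpace N] [T2Space N] [CompactSpace N]
    [ChartedSpace (EuclideanSpace ℝ (Fin n)) N] [IsManifold (𝓡 n) ∞ N]
    [RiemannianBundle (fun x : N => TangentSpace (𝓡 n) x)]
    [IsContMDiffRiemannianBundle (𝓡 n) ∞ (EuclideanSpace ℝ (Fin n))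
      (fun x : N => TangentSpace (𝓡 n) x)]
    (k : ℕ) (hk1 : 1 ≤ k) (hkn : k ≤ n)
    (S : Π x : N, TangentSpace (𝓡 n) x →L[ℝ] TangentSpace (𝓡 n) x →L[ℝ] ℝ)
    (hSsymm : ∀ x v w, S x v w = S x w v)
    (hScont : Continuous fun x : N =>
      TotalSpace.mk' (EuclideanSpace ℝ (Fin n) →L[ℝ] EuclideanSpace ℝ (Fin n) →L[ℝ] ℝ)
        (E := fun x : N => TangentSpace (𝓡 n) x →L[ℝ] TangentSpace (𝓡 n) x →L[ℝ] ℝ) x (S x))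
    (ψ : N → ℝ → ℝ)
    (hψ : ContMDiff ((𝓡 n).prod 𝓘(ℝ, ℝ)) 𝓘(ℝ, ℝ) 1 (fun p : N × ℝ => ψ p.1 p.2))
    (δlo δhi : ℝ) (hδlo : δlo < 0) (hδhi : 0 < δhi)
    (hi : ∀ x : N, SigmaK.MemGammaPlus k (fun v w => S x v w))
    (hii : ∀ x : N, ψ x δlo < SigmaK.sigmaForm k (fun v w => S x v w) ^ (1 / k : ℝ) ∧
      SigmaK.sigmaForm k (fun v w => S x v w) ^ (1 / k : ℝ) < ψ x δhi)
    (u : N → ℝ) (hu : ContMDiff (𝓡 n) 𝓘(ℝ, ℝ) 2 u)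
    (hsol : SigmaK.IsSolution k S ψ u)
    (hbound : ∀ x : N, δlo ≤ u x ∧ u x ≤ δhi) :
    ∀ x : N, δlo < u x ∧ u x < δhi := by

  have hM : ∀ x, (SigmaK.gramMatrix (SigmaK.modifiedHess S u x)).IsHermitian := fun x =>
    SigmaK.isHermitian_gramMatrix_of_sigmaForm_pos hk1 (hsol x).1
  have hSM : ∀ x, (SigmaK.gramMatrix fun v w => S x v w).IsHermitian := fun x =>
    SigmaK.isHermitian_gramMatrix (hSsymm x)
  have hkf : ∀ x : N, k ≤ Module.finrank ℝ (TangentSpace (𝓡 n) x) := fun x =>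
    hkn.trans_eq (SigmaK.finrank_tangentSpace x).symm
  have hk0 : (0 : ℝ) ≤ 1 / k := by positivity
  intro x
  obtain ⟨hpos, heq, -⟩ := hsol x
  constructor
  · refine lt_of_le_of_ne (hbound x).1 fun hx => ?_
    have hmin : IsLocalMin u x := Filter.Eventually.of_forall fun y => hx ▸ (hbound y).1
    have hle := SigmaK.matSigma_le_of_isLocalMin hkn hu hmin (hSsymm x) (hi x) (hM x) k le_rfl
    have hS := SigmaK.matSigma_pos_of_memGammaPlus (hSM x) (hkf x) (hi x) k le_rfl
    rw [← SigmaK.sigmaForm_eq_matSigma (hM x) (hkf x),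
      ← SigmaK.sigmaForm_eq_matSigma (hSM x) (hkf x)] at hle
    rw [← SigmaK.sigmaForm_eq_matSigma (hSM x) (hkf x)] at hS
    have := Real.rpow_le_rpow hS.le hle hk0
    rw [heq, ← hx] at this
    exact this.not_gt (hii x).1
  · refine lt_of_le_of_ne (hbound x).2 fun hx => ?_
    have hmax : IsLocalMax u x := Filter.Eventually.of_forall fun y => hx ▸ (hbound y).2
    -- Here the smaller form is the modified Hessian, so its own admissibility at `x` is what
    -- monotonicity requires.
    have hle := SigmaK.matSigma_le_of_isLocalMax hkn hu hmax (hSsymm x)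
      (SigmaK.matSigma_modifiedHess_pos hk1 hkn hSsymm hScont hi hu (fun y => (hsol y).1) x)
      (hM x) k le_rfl
    rw [← SigmaK.sigmaForm_eq_matSigma (hM x) (hkf x),
      ← SigmaK.sigmaForm_eq_matSigma (hSM x) (hkf x)] at hle
    have := Real.rpow_le_rpow hpos.le hle hk0
    rw [heq, hx] at this
    exact this.not_gt (hii x).2
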